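/- Let $S^1=\mathbb{R}/2\pi\mathbb{Z}$ and let $S^2\subset\mathbb{R}^3$ be the unit sphere. For $\theta\in S^1$ let $r_\theta\colon S^2\to S^2$ be the rotation about the $x_3$-axis through the angle $\theta$, and define the diffeomorphism $r$ of $S^1\times S^2$ by $r(\theta,\mathbf{x})=(\theta,r_\theta(\mathbf{x}))$. For a smooth manifold $M$, let $\mathcal{D}(M)=\mathrm{Diff}(M)/\mathrm{Diff}_0(M)$ be the diffeotopy group, that is, the quotient of the group $\mathrm{Diff}(M)$ of all smooth diffeomorphisms of $M$ by the normal subgroup $\mathrm{Diff}_0(M)$ of diffeomorphisms that are smoothly isotopic to the identity. Then the class $[r]$ has order exactly $2$ in $\mathcal{D}(S^1\times S^2)$. -/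

import Mathlib

open scoped Manifold ContDiff

noncomputable section

section Diffeotopy

variable {E : Type*} [NormedAddCommGroup E] [NormedSpace ℝ E]
  {H : Type*} [TopologicalSpace H] (I : ModelWithCorners ℝ E H)
  (M : Type*) [TopologicalSpace M] [ChartedSpace H M]

/-- `Diff(M)`, the group of smooth diffeomorphisms of `M` under composition. -/
abbrev Diff : Type _ := M ≃ₘ⟮I, I⟯ M

variable {I M}

instance instGroupDiff : Group (Diff I M) where
  mul f g := g.trans f
  one := Diffeomorph.refl I M ∞
  inv f := f.symm
  mul_assoc _ _ _ := rfl
  one_mul _ := rfl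
  mul_one _ := rfl
  inv_mul_cancel f := f.self_trans_symm

/-- Two diffeomorphisms of `M` are isotopic if they are joined by a family `φ t`, `t ∈ [0, 1]`, of
diffeomorphisms which is smooth together with its inverse family, that is, such that
`(t, x) ↦ (t, φ t x)` is a level-preserving diffeomorphism of `[0, 1] × M`. -/
def Isotopic (f g : Diff I M) : Prop :=
  ∃ φ : Set.Icc (0 : ℝ) 1 → Diff I M,
    ContMDiff ((𝓡∂ 1).prod I) I ∞ (fun p : Set.Icc (0 : ℝ) 1 × M => φ p.1 p.2) ∧
    ContMDiff ((𝓡∂ 1).prod I) I ∞ (fun p : Set.Icc (0 : ℝ) 1 × M => (φ p.1).symm p.2) ∧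
    φ 0 = f ∧ φ 1 = g

variable (I M)

/-- `Diff₀(M)`, the subgroup of the diffeomorphisms isotopic to the identity. -/
def Diff₀ : Subgroup (Diff I M) where
  carrier := {f | Isotopic 1 f}
  one_mem' := ⟨fun _ => 1, contMDiff_snd, contMDiff_snd, rfl, rfl⟩
  mul_mem' := by
    rintro f g ⟨φ, hφ, hφ', h0, h1⟩ ⟨ψ, hψ, hψ', k0, k1⟩
    refine ⟨fun t => φ t * ψ t, ?_, ?_, ?_, ?_⟩
    · exact hφ.comp (contMDiff_fst.prodMk hψ)
    · exact hψ'.comp (contMDiff_fst.prodMk hφ')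
    · simp [h0, k0]
    · simp [h1, k1]
  inv_mem' := by
    rintro f ⟨φ, hφ, hφ', h0, h1⟩
    refine ⟨fun t => (φ t)⁻¹, hφ', hφ, ?_, ?_⟩
    · simp [h0]
    · simp [h1]

instance instNormalDiff₀ : (Diff₀ I M).Normal where
  conj_mem := by
    rintro f ⟨φ, hφ, hφ', h0, h1⟩ g
    refine ⟨fun t => g * φ t * g⁻¹, ?_, ?_, ?_, ?_⟩
    · exact g.contMDiff.comp
        (hφ.comp (contMDiff_fst.prodMk (g.symm.contMDiff.comp contMDiff_snd)))
    · exact g.contMDiff.comp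
        (hφ'.comp (contMDiff_fst.prodMk (g.symm.contMDiff.comp contMDiff_snd)))
    · simp [h0]
    · simp [h1]

/-- The diffeotopy group `𝒟(M) = Diff(M) / Diff₀(M)`. -/
abbrev DiffeotopyGroup : Type _ := Diff I M ⧸ Diff₀ I M

end Diffeotopy

/-- The unit sphere in Euclidean `3`-space. -/
abbrev S2 : Type := Metric.sphere (0 : EuclideanSpace ℝ (Fin 3)) 1

/-- The linear map of `ℝ³` that rotates about the `x₃`-axis through the angle `θ`, where
`z = exp (iθ)`, so `cos θ = re z` and `sin θ = im z`. -/
def rotVec (z : Circle) (x : EuclideanSpace ℝ (Fin 3)) : EuclideanSpace ℝ (Fin 3) :=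
  !₂[(z : ℂ).re * x 0 - (z : ℂ).im * x 1, (z : ℂ).im * x 0 + (z : ℂ).re * x 1, x 2]

theorem rotVec_exp (θ : ℝ) (x : EuclideanSpace ℝ (Fin 3)) :
    rotVec (Circle.exp θ) x =
      !₂[Real.cos θ * x 0 - Real.sin θ * x 1, Real.sin θ * x 0 + Real.cos θ * x 1, x 2] := by
  simp [rotVec, Circle.coe_exp, Complex.exp_ofReal_mul_I_re, Complex.exp_ofReal_mul_I_im]

theorem circle_re_sq_add_im_sq (z : Circle) : (z : ℂ).re ^ 2 + (z : ℂ).im ^ 2 = 1 := by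
  have h := Circle.normSq_coe z
  rw [Complex.normSq_apply] at h
  nlinarith

theorem rotVec_mem (z : Circle) (x : S2) :
    rotVec z x ∈ Metric.sphere (0 : EuclideanSpace ℝ (Fin 3)) 1 := by
  have hx : ‖(x : EuclideanSpace ℝ (Fin 3))‖ = 1 := norm_eq_of_mem_sphere x
  have hz := circle_re_sq_add_im_sq z
  rw [EuclideanSpace.norm_eq, Real.sqrt_eq_one, Fin.sum_univ_three] at hx
  simp only [Real.norm_eq_abs, sq_abs] at hx
  rw [mem_sphere_zero_iff_norm, EuclideanSpace.norm_eq, Real.sqrt_eq_one, Fin.sum_univ_three]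
  simp only [Real.norm_eq_abs, sq_abs, rotVec, PiLp.toLp_apply, Matrix.cons_val]
  linear_combination hx + (x.1 0 ^ 2 + x.1 1 ^ 2) * hz

theorem rotVec_rotVec_inv (z : Circle) (x : EuclideanSpace ℝ (Fin 3)) :
    rotVec z (rotVec z⁻¹ x) = x := by
  have hz := circle_re_sq_add_im_sq z
  ext i
  fin_cases i
  · simp [rotVec]
    linear_combination x 0 * hz
  · simp [rotVec]
    linear_combination x 1 * hz
  · simp [rotVec]

/-- The rotation `r_θ` of `S²` about the `x₃`-axis through the angle `θ`, where `z = exp (iθ)`. -/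
def rotS2 (z : Circle) (x : S2) : S2 := ⟨rotVec z x, rotVec_mem z x⟩

theorem rotS2_rotS2_inv (z : Circle) (x : S2) : rotS2 z (rotS2 z⁻¹ x) = x :=
  Subtype.ext (rotVec_rotVec_inv z x)

theorem contMDiff_circle_coe :
    ContMDiff (𝓡 1) 𝓘(ℝ, ℂ) ∞ (fun z : Circle => (z : ℂ)) := by
  have := finrank_real_complex_fact'
  exact contMDiff_coe_sphere (E := ℂ)

theorem contMDiff_rotS2 :
    ContMDiff ((𝓡 1).prod (𝓡 2)) (𝓡 2) ∞ (fun p : Circle × S2 => rotS2 p.1 p.2) := by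
  have h : ContDiff ℝ ∞ (fun q : ℂ × EuclideanSpace ℝ (Fin 3) =>
      (!₂[q.1.re * q.2 0 - q.1.im * q.2 1, q.1.im * q.2 0 + q.1.re * q.2 1, q.2 2] :
        EuclideanSpace ℝ (Fin 3))) := by
    have hre : ContDiff ℝ ∞ (fun q : ℂ × EuclideanSpace ℝ (Fin 3) => q.1.re) :=
      Complex.reCLM.contDiff.comp contDiff_fst
    have him : ContDiff ℝ ∞ (fun q : ℂ × EuclideanSpace ℝ (Fin 3) => q.1.im) :=
      Complex.imCLM.contDiff.comp contDiff_fst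
    have hc : ∀ i, ContDiff ℝ ∞ (fun q : ℂ × EuclideanSpace ℝ (Fin 3) => q.2 i) := fun i =>
      (EuclideanSpace.proj (𝕜 := ℝ) i).contDiff.comp contDiff_snd
    rw [contDiff_euclidean]
    intro i
    fin_cases i
    · exact (hre.mul (hc 0)).sub (him.mul (hc 1))
    · exact (him.mul (hc 0)).add (hre.mul (hc 1))
    · exact hc 2
  have : Fact (Module.finrank ℝ (EuclideanSpace ℝ (Fin 3)) = 2 + 1) :=
    ⟨finrank_euclideanSpace_fin⟩
  have h1 : ContMDiff ((𝓡 1).prod (𝓡 2)) 𝓘(ℝ, ℂ) ∞ (fun p : Circle × S2 => (p.1 : ℂ)) :=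
    contMDiff_circle_coe.comp contMDiff_fst
  have h2 : ContMDiff ((𝓡 1).prod (𝓡 2)) 𝓘(ℝ, EuclideanSpace ℝ (Fin 3)) ∞
      (fun p : Circle × S2 => (p.2 : EuclideanSpace ℝ (Fin 3))) :=
    contMDiff_coe_sphere.comp contMDiff_snd
  exact (h.contMDiff.comp (h1.prodMk_space h2)).codRestrict_sphere
    (fun p => rotVec_mem p.1 p.2)

/-- The diffeomorphism `r(θ, x) = (θ, r_θ(x))` of `S¹ × S²`, where `S¹ = ℝ / 2πℤ` is identified
with the unit circle in `ℂ` through `θ ↦ exp (iθ)`. -/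
def twistDiffeo : Diff ((𝓡 1).prod (𝓡 2)) (Circle × S2) where
  toFun p := (p.1, rotS2 p.1 p.2)
  invFun p := (p.1, rotS2 p.1⁻¹ p.2)
  left_inv p := by
    have h := rotS2_rotS2_inv p.1⁻¹ p.2
    rw [inv_inv] at h
    simp [h]
  right_inv p := by simp [rotS2_rotS2_inv]
  contMDiff_toFun := contMDiff_fst.prodMk contMDiff_rotS2
  contMDiff_invFun :=
    contMDiff_fst.prodMk
      (contMDiff_rotS2.comp
        (((contMDiff_inv (𝓡 1) ∞).comp contMDiff_fst).prodMk contMDiff_snd))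

end

/-! The half-turn about the `x₁`-axis conjugates `r_θ` to `r_{-θ}` and is joined to the identity by
rotations, so `[r]` equals its inverse (`mk_twistDiffeo_sq`).

For `[r] ≠ 1`, an isotopy from the identity to `r` is differentiated along the circle of north
poles, in two directions tangent to `S²`. Since `S¹ × S²` is parallelizable, this is a homotopy of
loops of linearly independent pairs in `ℝ³`, from a constant loop to the loop rotating `(e₁, e₂)`
once about `e₃`. That loop represents the nontrivial element of `π₁(SO(3))`, so no such homotopy
exists (`rotation_frame_not_nullhomotopic`). In quaternions: a loop of orthonormal pairs may or may
not lift to a loop of conjugating quaternions, lifting is homotopy invariant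
(`HasSpinLift.homotopy_invariant`), and a lift of the rotation loop would be a continuous square
root on the circle. -/

noncomputable section

/-! ### The relation `[r]² = 1`. -/

/-- The linear map of `ℝ³` that rotates about the `x₁`-axis through the angle `s`. -/
def tiltVec (s : ℝ) (x : EuclideanSpace ℝ (Fin 3)) : EuclideanSpace ℝ (Fin 3) :=
  !₂[x 0, Real.cos s * x 1 - Real.sin s * x 2, Real.sin s * x 1 + Real.cos s * x 2]

theorem rotVec_one (x : EuclideanSpace ℝ (Fin 3)) : rotVec 1 x = x := by
  ext i
  fin_cases i <;> simp [rotVec]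

theorem sphere_coord_sq (x : S2) : x.1 0 ^ 2 + x.1 1 ^ 2 + x.1 2 ^ 2 = 1 := by
  have hx : ‖(x : EuclideanSpace ℝ (Fin 3))‖ = 1 := norm_eq_of_mem_sphere x
  rw [EuclideanSpace.norm_eq, Real.sqrt_eq_one, Fin.sum_univ_three] at hx
  simpa only [Real.norm_eq_abs, sq_abs] using hx

theorem mem_sphere_of_coord_sq {x : EuclideanSpace ℝ (Fin 3)}
    (hx : x 0 ^ 2 + x 1 ^ 2 + x 2 ^ 2 = 1) :
    x ∈ Metric.sphere (0 : EuclideanSpace ℝ (Fin 3)) 1 := by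
  rw [mem_sphere_zero_iff_norm, EuclideanSpace.norm_eq, Real.sqrt_eq_one, Fin.sum_univ_three]
  simpa only [Real.norm_eq_abs, sq_abs] using hx

theorem tiltVec_mem (s : ℝ) (x : S2) :
    tiltVec s x ∈ Metric.sphere (0 : EuclideanSpace ℝ (Fin 3)) 1 := by
  apply mem_sphere_of_coord_sq
  simp only [tiltVec, PiLp.toLp_apply, Matrix.cons_val]
  linear_combination sphere_coord_sq x + (x.1 1 ^ 2 + x.1 2 ^ 2) * Real.sin_sq_add_cos_sq s

/-- The rotation of `S²` about the `x₁`-axis through the angle `s`. -/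
def tiltS2 (s : ℝ) (x : S2) : S2 := ⟨tiltVec s x, tiltVec_mem s x⟩

theorem tiltS2_neg_tiltS2 (s : ℝ) (x : S2) : tiltS2 (-s) (tiltS2 s x) = x := by
  have hs := Real.sin_sq_add_cos_sq s
  apply Subtype.ext
  ext i
  fin_cases i
  · simp [tiltS2, tiltVec]
  · simp [tiltS2, tiltVec]
    linear_combination x.1 1 * hs
  · simp [tiltS2, tiltVec]
    linear_combination x.1 2 * hs

theorem tiltS2_zero (x : S2) : tiltS2 0 x = x := by
  apply Subtype.ext
  ext i
  fin_cases i <;> simp [tiltS2, tiltVec]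

theorem contMDiff_tiltS2 :
    ContMDiff (𝓘(ℝ, ℝ).prod (𝓡 2)) (𝓡 2) ∞ (fun p : ℝ × S2 => tiltS2 p.1 p.2) := by
  have h : ContDiff ℝ ∞ (fun q : ℝ × EuclideanSpace ℝ (Fin 3) => tiltVec q.1 q.2) := by
    have hc : ∀ i, ContDiff ℝ ∞ (fun q : ℝ × EuclideanSpace ℝ (Fin 3) => q.2 i) := fun i =>
      (EuclideanSpace.proj (𝕜 := ℝ) i).contDiff.comp contDiff_snd
    have hcos : ContDiff ℝ ∞ (fun q : ℝ × EuclideanSpace ℝ (Fin 3) => Real.cos q.1) :=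
      Real.contDiff_cos.comp contDiff_fst
    have hsin : ContDiff ℝ ∞ (fun q : ℝ × EuclideanSpace ℝ (Fin 3) => Real.sin q.1) :=
      Real.contDiff_sin.comp contDiff_fst
    rw [contDiff_euclidean]
    intro i
    fin_cases i
    · exact hc 0
    · exact (hcos.mul (hc 1)).sub (hsin.mul (hc 2))
    · exact (hsin.mul (hc 1)).add (hcos.mul (hc 2))
  have : Fact (Module.finrank ℝ (EuclideanSpace ℝ (Fin 3)) = 2 + 1) :=
    ⟨finrank_euclideanSpace_fin⟩
  have h2 : ContMDiff (𝓘(ℝ, ℝ).prod (𝓡 2)) 𝓘(ℝ, EuclideanSpace ℝ (Fin 3)) ∞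
      (fun p : ℝ × S2 => (p.2 : EuclideanSpace ℝ (Fin 3))) :=
    contMDiff_coe_sphere.comp contMDiff_snd
  exact (h.contMDiff.comp (contMDiff_fst.prodMk_space h2)).codRestrict_sphere
    (fun p => tiltVec_mem p.1 p.2)

/-- The diffeomorphism of `S¹ × S²` that rotates every sphere about the `x₁`-axis through the
angle `s`. -/
def tiltDiffeo (s : ℝ) : Diff ((𝓡 1).prod (𝓡 2)) (Circle × S2) where
  toFun p := (p.1, tiltS2 s p.2)
  invFun p := (p.1, tiltS2 (-s) p.2)
  left_inv p := by simp [tiltS2_neg_tiltS2]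
  right_inv p := by
    have h := tiltS2_neg_tiltS2 (-s) p.2
    rw [neg_neg] at h
    simp [h]
  contMDiff_toFun :=
    contMDiff_fst.prodMk (contMDiff_tiltS2.comp (contMDiff_const.prodMk contMDiff_snd))
  contMDiff_invFun :=
    contMDiff_fst.prodMk (contMDiff_tiltS2.comp (contMDiff_const.prodMk contMDiff_snd))

theorem tiltDiffeo_mem_Diff₀ (s : ℝ) :
    tiltDiffeo s ∈ Diff₀ ((𝓡 1).prod (𝓡 2)) (Circle × S2) := by
  have ht : ∀ c : ℝ, ContMDiff ((𝓡∂ 1).prod ((𝓡 1).prod (𝓡 2))) 𝓘(ℝ, ℝ) ∞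
      (fun p : Set.Icc (0 : ℝ) 1 × (Circle × S2) => (p.1 : ℝ) * c) := fun c =>
    ((contDiff_id.mul contDiff_const).contMDiff (f := fun x : ℝ => x * c)).comp
      (contMDiff_subtypeVal_Icc.comp contMDiff_fst)
  refine ⟨fun t => tiltDiffeo (t * s), ?_, ?_, ?_, ?_⟩
  · exact (contMDiff_fst.comp contMDiff_snd).prodMk
      (contMDiff_tiltS2.comp ((ht s).prodMk (contMDiff_snd.comp contMDiff_snd)))
  · have h := (contMDiff_fst.comp contMDiff_snd).prodMk
      (contMDiff_tiltS2.comp ((ht (-s)).prodMk (contMDiff_snd.comp contMDiff_snd)))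
    simp only [mul_neg] at h
    exact h
  · ext p : 1
    change (p.1, tiltS2 ((0 : ℝ) * s) p.2) = p
    rw [zero_mul, tiltS2_zero]
  · simp

/-- The half-turn about the `x₁`-axis reverses the `x₃`-axis, hence the sense of rotation about it.
-/
theorem tiltDiffeo_pi_conj :
    tiltDiffeo Real.pi * twistDiffeo⁻¹ * (tiltDiffeo Real.pi)⁻¹ = twistDiffeo := by
  rw [mul_inv_eq_iff_eq_mul]
  ext p : 1
  change (p.1, tiltS2 Real.pi (rotS2 p.1⁻¹ p.2)) = (p.1, rotS2 p.1 (tiltS2 Real.pi p.2))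
  congr 1
  apply Subtype.ext
  ext i
  fin_cases i <;> simp [tiltS2, tiltVec, rotS2, rotVec] <;> ring

theorem mk_twistDiffeo_sq :
    (QuotientGroup.mk twistDiffeo : DiffeotopyGroup ((𝓡 1).prod (𝓡 2)) (Circle × S2)) ^ 2 = 1 := by
  have h : (QuotientGroup.mk (tiltDiffeo Real.pi) :
      DiffeotopyGroup ((𝓡 1).prod (𝓡 2)) (Circle × S2)) = 1 :=
    (QuotientGroup.eq_one_iff _).2 (tiltDiffeo_mem_Diff₀ _)
  have h2 := congrArg (QuotientGroup.mk :
    _ → DiffeotopyGroup ((𝓡 1).prod (𝓡 2)) (Circle × S2)) tiltDiffeo_pi_conj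
  rw [QuotientGroup.mk_mul, QuotientGroup.mk_mul, QuotientGroup.mk_inv, QuotientGroup.mk_inv, h,
    one_mul, inv_one, mul_one] at h2
  rw [sq]
  nth_rewrite 1 [← h2]
  exact inv_mul_cancel _

end

/-! ### Quaternionic lifts of families of orthonormal pairs. -/

noncomputable section

open Quaternion

/-- The inclusion of `ℝ³` into the quaternions as the purely imaginary ones. -/
def quatOfVec : EuclideanSpace ℝ (Fin 3) →ₗ[ℝ] ℍ[ℝ] where
  toFun x := ⟨0, x 0, x 1, x 2⟩
  map_add' x y := by
    apply Quaternion.ext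
    · exact (add_zero (0 : ℝ)).symm
    all_goals rfl
  map_smul' c x := by
    apply Quaternion.ext
    · exact (mul_zero c).symm
    all_goals rfl

theorem continuous_quatOfVec : Continuous quatOfVec :=
  quatOfVec.continuous_of_finiteDimensional

@[simp] theorem quatOfVec_re (x) : (quatOfVec x).re = 0 := rfl
@[simp] theorem quatOfVec_imI (x) : (quatOfVec x).imI = x 0 := rfl
@[simp] theorem quatOfVec_imJ (x) : (quatOfVec x).imJ = x 1 := rfl
@[simp] theorem quatOfVec_imK (x) : (quatOfVec x).imK = x 2 := rfl

theorem quatOfVec_mul_self {x : EuclideanSpace ℝ (Fin 3)} (hx : ‖x‖ = 1) :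
    quatOfVec x * quatOfVec x = -1 := by
  have h := sphere_coord_sq ⟨x, by simp [hx]⟩
  ext
  · simp; linear_combination -h
  · simp; ring
  · simp; ring
  · simp; ring

theorem quatOfVec_mul_comm {x y : EuclideanSpace ℝ (Fin 3)} (h : inner ℝ x y = 0) :
    quatOfVec x * quatOfVec y = -(quatOfVec y * quatOfVec x) := by
  rw [PiLp.inner_apply, Fin.sum_univ_three] at h
  simp only [RCLike.inner_apply, conj_trivial] at h
  ext
  · simp; linear_combination -2 * h
  · simp; ring
  · simp; ring
  · simp; ring

/-- The quaternion that intertwines two anticommuting pairs `(u, v)` and `(u', v')` of square roots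
of `-1`. -/
def intertwiner (u v u' v' : ℍ[ℝ]) : ℍ[ℝ] := 1 - u' * u - v' * v - u' * v' * (u * v)

/-- The intertwiner is the sum of `g' g⁻¹` over `g = 1, u, v, uv`, representatives of the quaternion
group modulo `±1`; translation by a generator permutes the terms. -/
theorem intertwiner_mul_left {u v u' v' : ℍ[ℝ]} (hu : u * u = -1)
    (huv : u * v = -(v * u)) (hu' : u' * u' = -1) :
    intertwiner u v u' v' * u = u' * intertwiner u v u' v' := by
  have h1 : u * v * u = v := by rw [huv, neg_mul, mul_assoc, hu]; simp
  have e1 : intertwiner u v u' v' * u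
      = u - u' * (u * u) - v' * (v * u) - u' * v' * (u * v * u) := by
    unfold intertwiner; noncomm_ring
  have e2 : u' * intertwiner u v u' v'
      = u' - (u' * u') * u - u' * v' * v - (u' * u') * v' * (u * v) := by
    unfold intertwiner; noncomm_ring
  rw [e1, e2, h1, hu, hu', huv]
  noncomm_ring

theorem intertwiner_mul_right {u v u' v' : ℍ[ℝ]} (hv : v * v = -1)
    (hv' : v' * v' = -1) (huv' : u' * v' = -(v' * u')) :
    intertwiner u v u' v' * v = v' * intertwiner u v u' v' := by
  have h1 : v' * (u' * v') = u' := by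
    rw [huv', mul_neg, ← mul_assoc, hv']; simp
  have e1 : intertwiner u v u' v' * v
      = v - u' * (u * v) - v' * (v * v) - u' * v' * u * (v * v) := by
    unfold intertwiner; noncomm_ring
  have e2 : v' * intertwiner u v u' v'
      = v' - v' * u' * u - (v' * v') * v - (v' * (u' * v')) * (u * v) := by
    unfold intertwiner; noncomm_ring
  rw [e1, e2, h1, hv, hv', huv']
  noncomm_ring

/-- Each of the four terms equals `1`. The value being nonzero, nearby pairs have an invertible
intertwiner. -/
theorem intertwiner_self {u v : ℍ[ℝ]} (hu : u * u = -1) (hv : v * v = -1)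
    (huv : u * v = -(v * u)) : intertwiner u v u v = ((4 : ℝ) : ℍ[ℝ]) := by
  have h : u * v * (u * v) = -1 := by
    nth_rewrite 1 [huv]
    rw [neg_mul, mul_assoc, ← mul_assoc u u v, hu, neg_one_mul, mul_neg, hv, neg_neg]
  rw [intertwiner, hu, hv, h]
  norm_num
  exact QuaternionAlgebra.coe_ofNat.symm

/-- The pair `(u, v)` of quaternion-valued maps is, up to conjugation by a continuous family of
nonzero quaternions, the constant pair `(i, j)`. -/
def HasSpinLift {X : Type*} [TopologicalSpace X] (u v : X → ℍ[ℝ]) : Prop :=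
  ∃ q : X → ℍ[ℝ], Continuous q ∧ ∀ x, q x ≠ 0 ∧ q x * quatOfVec !₂[1, 0, 0] = u x * q x ∧
    q x * quatOfVec !₂[0, 1, 0] = v x * q x

theorem HasSpinLift.of_intertwining {X : Type*} [TopologicalSpace X] {u v u' v' : X → ℍ[ℝ]}
    (h : HasSpinLift u v) (p : X → ℍ[ℝ]) (hp : Continuous p) (hp0 : ∀ x, p x ≠ 0)
    (hu : ∀ x, p x * u x = u' x * p x) (hv : ∀ x, p x * v x = v' x * p x) :
    HasSpinLift u' v' := by
  obtain ⟨q, hq, h⟩ := h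
  refine ⟨fun x => p x * q x, hp.mul hq, fun x => ⟨mul_ne_zero (hp0 x) (h x).1, ?_, ?_⟩⟩
  · dsimp only
    rw [mul_assoc, (h x).2.1, ← mul_assoc, hu, mul_assoc]
  · dsimp only
    rw [mul_assoc, (h x).2.2, ← mul_assoc, hv, mul_assoc]

/-- By compactness of `X`, for `t` near `s` the intertwiner between the pairs at times `s` and `t`
is nonzero for all `x` at once. It transports lifts both ways, so liftability is locally constant in
`t`. -/
theorem HasSpinLift.homotopy_invariant {T X : Type*} [TopologicalSpace T] [PreconnectedSpace T]
    [TopologicalSpace X] [CompactSpace X] {u v : T × X → ℍ[ℝ]} (hu : Continuous u)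
    (hv : Continuous v) (huu : ∀ p, u p * u p = -1) (hvv : ∀ p, v p * v p = -1)
    (huv : ∀ p, u p * v p = -(v p * u p)) {s t : T}
    (h : HasSpinLift (fun x => u (s, x)) (fun x => v (s, x))) :
    HasSpinLift (fun x => u (t, x)) (fun x => v (t, x)) := by
  have key : IsLocallyConstant
      (fun t => HasSpinLift (fun x => u (t, x)) (fun x => v (t, x))) := by
    rw [IsLocallyConstant.iff_eventually_eq]
    intro s
    let p : T × X → ℍ[ℝ] := fun y =>
      intertwiner (u (s, y.2)) (v (s, y.2)) (u y) (v y)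
    have hus : Continuous fun y : T × X => u (s, y.2) := by fun_prop
    have hvs : Continuous fun y : T × X => v (s, y.2) := by fun_prop
    have hp : Continuous p := by
      change Continuous fun y : T × X => 1 - u y * u (s, y.2) - v y * v (s, y.2)
        - u y * v y * (u (s, y.2) * v (s, y.2))
      fun_prop
    have hopen : IsOpen {y | p y ≠ 0} := isOpen_ne_fun hp continuous_const
    have hev : ∀ᶠ t in nhds s, ∀ x ∈ (Set.univ : Set X), p (t, x) ≠ 0 := by
      apply isCompact_univ.eventually_forall_of_forall_eventually
      intro x _
      apply hopen.mem_nhds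
      change intertwiner _ _ _ _ ≠ 0
      rw [intertwiner_self (huu _) (hvv _) (huv _)]
      exact fun h => by simpa using congrArg QuaternionAlgebra.re h
    filter_upwards [hev] with t ht
    have hpt : Continuous fun x => p (t, x) := by fun_prop
    have hl : ∀ x, p (t, x) * u (s, x) = u (t, x) * p (t, x) := fun x =>
      intertwiner_mul_left (huu _) (huv _) (huu _)
    have hr : ∀ x, p (t, x) * v (s, x) = v (t, x) * p (t, x) := fun x =>
      intertwiner_mul_right (hvv _) (hvv _) (huv _)
    have h0 : ∀ x, p (t, x) ≠ 0 := fun x => ht x trivial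
    have swap : ∀ {a b c : ℍ[ℝ]}, a ≠ 0 → a * b = c * a → a⁻¹ * c = b * a⁻¹ := by
      intro a b c ha hab
      rw [eq_mul_inv_iff_mul_eq₀ ha, mul_assoc, ← hab, inv_mul_cancel_left₀ ha]
    apply propext
    constructor
    · intro h
      exact h.of_intertwining (fun x => (p (t, x))⁻¹) (hpt.inv₀ h0)
        (fun x => inv_ne_zero (h0 x)) (fun x => swap (h0 x) (hl x))
        (fun x => swap (h0 x) (hr x))
    · intro h
      exact h.of_intertwining (fun x => p (t, x)) hpt h0 hl hr
  exact (key.apply_eq_of_preconnectedSpace s t).mp h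

/-- Multiplied by `exp (-iθ/2)`, a square root becomes a continuous function `ℝ → {±1}`, hence
constant, yet it changes sign from `0` to `2π`. -/
theorem not_exists_continuous_sqrt_circle :
    ¬ ∃ s : Circle → ℂ, Continuous s ∧ ∀ z, s z ^ 2 = z := by
  rintro ⟨s, hs, h⟩
  let g : ℝ → ℂ := fun θ => s (Circle.exp θ) * Complex.exp (-(θ / 2 * Complex.I))
  have hg : Continuous g := by
    have : Continuous fun θ : ℝ => s (Circle.exp θ) := hs.comp (map_continuous _)
    change Continuous fun θ : ℝ => s (Circle.exp θ) * Complex.exp (-(θ / 2 * Complex.I))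
    fun_prop
  have hg2 : ∀ θ, g θ ^ 2 = 1 := by
    intro θ
    change (s (Circle.exp θ) * Complex.exp (-(θ / 2 * Complex.I))) ^ 2 = 1
    rw [mul_pow, h, Circle.coe_exp, ← Complex.exp_nat_mul, ← Complex.exp_add]
    simp only [Nat.cast_ofNat]
    ring_nf
    simp
  have hconst : g 0 = g (2 * Real.pi) := by
    have := isPreconnected_univ.eq_one_or_eq_neg_one_of_sq_eq (α := ℝ) (f := g)
      hg.continuousOn (fun x _ => hg2 x)
    rcases this with h | h
    · rw [h (Set.mem_univ _), h (Set.mem_univ _)]; rfl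
    · rw [h (Set.mem_univ _), h (Set.mem_univ _)]; rfl
  have h1 : g (2 * Real.pi) = -s 1 := by
    have e : (-(((2 * Real.pi : ℝ) : ℂ) / 2 * Complex.I)) = -(Real.pi * Complex.I) := by
      push_cast; ring
    change s (Circle.exp (2 * Real.pi)) *
      Complex.exp (-(((2 * Real.pi : ℝ) : ℂ) / 2 * Complex.I)) = _
    rw [Circle.exp_two_pi, e, Complex.exp_neg, Complex.exp_pi_mul_I]
    norm_num
  have h0 : g 0 = s 1 := by simp [g]
  have hs1 := h 1
  rw [h0, h1, eq_neg_iff_add_eq_zero, ← two_mul] at hconst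
  have : s 1 = 0 := by simpa using hconst
  simp [this] at hs1

theorem not_hasSpinLift_rotation :
    ¬ HasSpinLift (fun z : Circle => quatOfVec (rotVec z !₂[1, 0, 0]))
      (fun z : Circle => quatOfVec (rotVec z !₂[0, 1, 0])) := by
  rintro ⟨q, hq, h⟩
  have hne : ∀ z, (q z).re ^ 2 + (q z).imK ^ 2 ≠ 0 ∧
      (q z).re ^ 2 - (q z).imK ^ 2 = (z : ℂ).re * ((q z).re ^ 2 + (q z).imK ^ 2) ∧
      2 * (q z).re * (q z).imK = (z : ℂ).im * ((q z).re ^ 2 + (q z).imK ^ 2) := by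
    intro z
    obtain ⟨h0, h1, h2⟩ := h z
    have e1 := congrArg QuaternionAlgebra.re h1
    have e2 := congrArg QuaternionAlgebra.imI h1
    have e3 := congrArg QuaternionAlgebra.imJ h1
    have e4 := congrArg QuaternionAlgebra.imK h1
    have e5 := congrArg QuaternionAlgebra.re h2
    have e6 := congrArg QuaternionAlgebra.imK h2
    simp [rotVec] at e1 e2 e3 e4 e5 e6
    -- Conceptually, `q` conjugates `k = ij` to the product of the rotated pair, again `k`, so it
    -- commutes with `k`. What remains, `re + imK · i`, squares to a positive multiple of `z`.
    have hI : (q z).imI = 0 := by linarith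
    have hJ : (q z).imJ = 0 := by linarith
    refine ⟨fun h => h0 ?_, ?_, ?_⟩
    · have hre : (q z).re = 0 := by nlinarith [sq_nonneg (q z).re, sq_nonneg (q z).imK]
      have hK : (q z).imK = 0 := by nlinarith [sq_nonneg (q z).re, sq_nonneg (q z).imK]
      ext <;> simp [hre, hI, hJ, hK]
    · linear_combination (q z).re * e2 - (q z).imK * e3
    · linear_combination (q z).imK * e2 + (q z).re * e3
  have hre : Continuous fun z => (q z).re := Quaternion.continuous_re.comp hq
  have hK : Continuous fun z => (q z).imK := Quaternion.continuous_imK.comp hq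
  let n : Circle → ℝ := fun z => √((q z).re ^ 2 + (q z).imK ^ 2)
  have hn : Continuous n := by
    change Continuous fun z => √((q z).re ^ 2 + (q z).imK ^ 2)
    fun_prop
  have hn2 : ∀ z, n z ^ 2 = (q z).re ^ 2 + (q z).imK ^ 2 := fun z =>
    Real.sq_sqrt (by positivity)
  have hn0 : ∀ z, n z ≠ 0 := fun z hz => (hne z).1 (by rw [← hn2, hz]; norm_num)
  refine not_exists_continuous_sqrt_circle
    ⟨fun z => (⟨(q z).re / n z, (q z).imK / n z⟩ : ℂ), ?_, fun z => ?_⟩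
  · exact Complex.equivRealProdCLM.symm.continuous.comp ((hre.div hn hn0).prodMk (hK.div hn hn0))
  · obtain ⟨-, h1, h2⟩ := hne z
    rw [← hn2] at h1 h2
    have := hn0 z
    apply Complex.ext
    · simp only [sq, Complex.mul_re]
      field_simp
      linear_combination h1
    · simp only [sq, Complex.mul_im]
      field_simp
      linear_combination h2

end

/-! ### The rotating frame is not null-homotopic. -/

noncomputable section

open Quaternion

/-- The loop `z ↦ (rotVec z e₁, rotVec z e₂)` of pairs of linearly independent vectors in `ℝ³` is
not homotopic to a constant loop through loops of such pairs. -/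
theorem rotation_frame_not_nullhomotopic
    (a b : Set.Icc (0 : ℝ) 1 × Circle → EuclideanSpace ℝ (Fin 3))
    (ha : Continuous a) (hb : Continuous b)
    (hab : ∀ p, ∀ α β : ℝ, α • a p + β • b p = 0 → α = 0 ∧ β = 0)
    (ha0 : ∀ z, a (0, z) = !₂[1, 0, 0]) (hb0 : ∀ z, b (0, z) = !₂[0, 1, 0])
    (ha1 : ∀ z, a (1, z) = rotVec z !₂[1, 0, 0])
    (hb1 : ∀ z, b (1, z) = rotVec z !₂[0, 1, 0]) : False := by
  have hane : ∀ p, ‖a p‖ ≠ 0 := by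
    intro p h
    have := (hab p 1 0 (by simp [norm_eq_zero.1 h])).1
    norm_num at this
  -- Gram–Schmidt: orthonormal pairs become anticommuting square roots of `-1`.
  let u := fun p => ‖a p‖⁻¹ • a p
  have hu : Continuous u := (ha.norm.inv₀ hane).smul ha
  have hu1 : ∀ p, ‖u p‖ = 1 := fun p => by simp [u, norm_smul, hane p]
  let c := fun p => b p - inner ℝ (u p) (b p) • u p
  have hc : Continuous c := hb.sub (Continuous.smul (hu.inner (𝕜 := ℝ) hb) hu)
  have hcne : ∀ p, ‖c p‖ ≠ 0 := by
    intro p h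
    have h' : c p = 0 := norm_eq_zero.1 h
    have := (hab p (-(inner ℝ (u p) (b p) * ‖a p‖⁻¹)) 1 (by
      rw [← h']
      simp only [c]
      nth_rewrite 3 [show u p = ‖a p‖⁻¹ • a p from rfl]
      module)).2
    norm_num at this
  have huc : ∀ p, inner ℝ (u p) (c p) = 0 := by
    intro p
    simp only [c, inner_sub_right, inner_smul_right, real_inner_self_eq_norm_sq, hu1]
    ring
  let v := fun p => ‖c p‖⁻¹ • c p
  have hv : Continuous v := (hc.norm.inv₀ hcne).smul hc
  have hv1 : ∀ p, ‖v p‖ = 1 := fun p => by simp [v, norm_smul, hcne p]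
  have huv : ∀ p, inner ℝ (u p) (v p) = 0 := fun p => by
    simp only [v, inner_smul_right, huc, mul_zero]
  -- Gram–Schmidt fixes pairs that are already orthonormal, so both end loops are unchanged.
  have hend : ∀ p, ‖a p‖ = 1 → ‖b p‖ = 1 → inner ℝ (a p) (b p) = 0 → u p = a p ∧ v p = b p := by
    intro p h1 h2 h3
    have hu : u p = a p := by simp [u, h1]
    have hc : c p = b p := by simp [c, hu, h3]
    exact ⟨hu, by simp [v, hc, h2]⟩
  have hrot : ∀ z : Circle, ‖rotVec z !₂[1, 0, 0]‖ = 1 ∧ ‖rotVec z !₂[0, 1, 0]‖ = 1 ∧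
      inner ℝ (rotVec z !₂[1, 0, 0]) (rotVec z !₂[0, 1, 0]) = 0 := by
    intro z
    refine ⟨?_, ?_, ?_⟩
    · simpa using rotVec_mem z ⟨!₂[1, 0, 0], mem_sphere_of_coord_sq (by simp)⟩
    · simpa using rotVec_mem z ⟨!₂[0, 1, 0], mem_sphere_of_coord_sq (by simp)⟩
    · rw [PiLp.inner_apply, Fin.sum_univ_three]
      simp [rotVec]
      ring
  have h0 : ∀ z, u (0, z) = !₂[1, 0, 0] ∧ v (0, z) = !₂[0, 1, 0] := by
    intro z
    have := hrot 1
    simp only [rotVec_one] at this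
    rw [← ha0 z, ← hb0 z] at this ⊢
    exact hend _ this.1 this.2.1 this.2.2
  have h1 : ∀ z, u (1, z) = rotVec z !₂[1, 0, 0] ∧ v (1, z) = rotVec z !₂[0, 1, 0] := by
    intro z
    have := hrot z
    rw [← ha1 z, ← hb1 z] at this ⊢
    exact hend _ this.1 this.2.1 this.2.2
  apply not_hasSpinLift_rotation
  have key := HasSpinLift.homotopy_invariant (continuous_quatOfVec.comp hu)
    (continuous_quatOfVec.comp hv) (fun p => quatOfVec_mul_self (hu1 p))
    (fun p => quatOfVec_mul_self (hv1 p)) (fun p => quatOfVec_mul_comm (huv p))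
    (s := 0) (t := 1)
    ⟨fun _ => 1, continuous_const, fun z => ⟨one_ne_zero, by simp [(h0 z).1],
      by simp [(h0 z).2]⟩⟩
  simpa only [Function.comp, (h1 _).1, (h1 _).2] using key

/-! ### A parametrization of `S²` near the north pole, and the ambient embedding. -/

/-- The vector of the inverse stereographic projection of `y` from the south pole. -/
def poleVec (y : ℝ × ℝ) : EuclideanSpace ℝ (Fin 3) :=
  !₂[2 * y.1 * (1 + y.1 ^ 2 + y.2 ^ 2)⁻¹, 2 * y.2 * (1 + y.1 ^ 2 + y.2 ^ 2)⁻¹,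
    (1 - y.1 ^ 2 - y.2 ^ 2) * (1 + y.1 ^ 2 + y.2 ^ 2)⁻¹]

theorem poleVec_mem (y : ℝ × ℝ) :
    poleVec y ∈ Metric.sphere (0 : EuclideanSpace ℝ (Fin 3)) 1 := by
  apply mem_sphere_of_coord_sq
  have : 1 + y.1 ^ 2 + y.2 ^ 2 ≠ 0 := by positivity
  simp only [poleVec, PiLp.toLp_apply, Matrix.cons_val]
  field_simp
  ring

/-- The inverse stereographic projection from the south pole, a smooth parametrization of `S²`
around the north pole. -/
def poleParam (y : ℝ × ℝ) : S2 := ⟨poleVec y, poleVec_mem y⟩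

theorem contDiff_poleVec : ContDiff ℝ ∞ poleVec := by
  have h : ContDiff ℝ ∞ fun y : ℝ × ℝ => (1 + y.1 ^ 2 + y.2 ^ 2)⁻¹ :=
    ContDiff.inv (by fun_prop) (fun y => by positivity)
  rw [contDiff_euclidean]
  intro i
  fin_cases i
  · exact (contDiff_const.mul contDiff_fst).mul h
  · exact (contDiff_const.mul contDiff_snd).mul h
  · exact ContDiff.mul (by fun_prop) h

theorem contMDiff_poleParam : ContMDiff 𝓘(ℝ, ℝ × ℝ) (𝓡 2) ∞ poleParam := by
  have : Fact (Module.finrank ℝ (EuclideanSpace ℝ (Fin 3)) = 2 + 1) :=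
    ⟨finrank_euclideanSpace_fin⟩
  exact contDiff_poleVec.contMDiff.codRestrict_sphere poleVec_mem

/-- The derivative of `poleVec` at the origin. -/
def poleDeriv : ℝ × ℝ →L[ℝ] EuclideanSpace ℝ (Fin 3) :=
  LinearMap.toContinuousLinearMap
    { toFun := fun y => !₂[2 * y.1, 2 * y.2, 0]
      map_add' := fun x y => by ext i; fin_cases i <;> simp <;> ring
      map_smul' := fun c y => by ext i; fin_cases i <;> simp <;> ring }

theorem poleDeriv_apply (y : ℝ × ℝ) : poleDeriv y = !₂[2 * y.1, 2 * y.2, 0] := rfl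

/-- The expressions `1 ± |y|²` are stationary at the origin, so only the linear factors contribute.
-/
theorem hasFDerivAt_poleVec : HasFDerivAt poleVec poleDeriv 0 := by
  have hn : HasFDerivAt (fun y : ℝ × ℝ => 1 + y.1 ^ 2 + y.2 ^ 2)
      (0 : ℝ × ℝ →L[ℝ] ℝ) 0 := by
    have := ((hasFDerivAt_fst (𝕜 := ℝ) (p := (0 : ℝ × ℝ))).pow 2).const_add 1 |>.add
      ((hasFDerivAt_snd (𝕜 := ℝ) (p := (0 : ℝ × ℝ))).pow 2)
    exact this.congr_fderiv (by ext <;> simp)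
  have hi : HasFDerivAt (fun y : ℝ × ℝ => (1 + y.1 ^ 2 + y.2 ^ 2)⁻¹)
      (0 : ℝ × ℝ →L[ℝ] ℝ) 0 := by
    have := (hasDerivAt_inv (x := (1 : ℝ)) one_ne_zero)
    have := HasDerivAt.comp_hasFDerivAt (0 : ℝ × ℝ) (by simpa using this) hn
    exact this.congr_fderiv (by simp)
  have h2 : HasFDerivAt (fun y : ℝ × ℝ => 1 - y.1 ^ 2 - y.2 ^ 2)
      (0 : ℝ × ℝ →L[ℝ] ℝ) 0 := by
    have := hn.const_sub 2
    simp only [neg_zero] at this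
    refine this.congr_of_eventuallyEq (Filter.Eventually.of_forall fun y => ?_)
    simp only
    ring
  rw [← hasFDerivWithinAt_univ, hasFDerivWithinAt_euclidean]
  intro i
  fin_cases i
  · have := ((hasFDerivAt_fst (𝕜 := ℝ) (p := (0 : ℝ × ℝ))).const_mul 2).mul hi
    exact (this.congr_fderiv (by ext <;> simp [poleDeriv_apply])).hasFDerivWithinAt
  · have := ((hasFDerivAt_snd (𝕜 := ℝ) (p := (0 : ℝ × ℝ))).const_mul 2).mul hi
    exact (this.congr_fderiv (by ext <;> simp [poleDeriv_apply])).hasFDerivWithinAt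
  · have := h2.mul hi
    exact (this.congr_fderiv (by ext <;> simp [poleDeriv_apply])).hasFDerivWithinAt

theorem inner_hasFDerivAt_eq_zero {V E : Type*} [NormedAddCommGroup V] [NormedSpace ℝ V]
    [NormedAddCommGroup E] [InnerProductSpace ℝ E] {f : V → E} {f' : V →L[ℝ] E} {x : V}
    (hf : HasFDerivAt f f' x) (h : ∀ y, ‖f y‖ = 1) (v : V) : inner ℝ (f x) (f' v) = 0 := by
  have h1 := hf.norm_sq
  simp only [h] at h1
  have h2 := congrArg (fun L => L v) (h1.unique (hasFDerivAt_const _ _))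
  simpa using h2

/-- The inclusion of `S¹ × S²` into `ℂ × ℝ³`. -/
def ambient (p : Circle × S2) : ℂ × EuclideanSpace ℝ (Fin 3) := (p.1, p.2)

theorem contMDiff_ambient : ContMDiff ((𝓡 1).prod (𝓡 2))
    𝓘(ℝ, ℂ × EuclideanSpace ℝ (Fin 3)) ∞ ambient := by
  have : Fact (Module.finrank ℝ (EuclideanSpace ℝ (Fin 3)) = 2 + 1) :=
    ⟨finrank_euclideanSpace_fin⟩
  exact (contMDiff_circle_coe.comp contMDiff_fst).prodMk_space
    (contMDiff_coe_sphere.comp contMDiff_snd)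

end

/-! ### Derivatives of diffeomorphisms along the circle of north poles. -/

noncomputable section

theorem mfderiv_ambient_injective (p : Circle × S2) :
    Function.Injective (mfderiv ((𝓡 1).prod (𝓡 2))
      𝓘(ℝ, ℂ × EuclideanSpace ℝ (Fin 3)) ambient p) := by
  have : Fact (Module.finrank ℝ (EuclideanSpace ℝ (Fin 3)) = 2 + 1) :=
    ⟨finrank_euclideanSpace_fin⟩
  have := finrank_real_complex_fact'
  have hA : MDifferentiableAt ((𝓡 1).prod (𝓡 2)) 𝓘(ℝ, ℂ × EuclideanSpace ℝ (Fin 3)) ambient p :=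
    contMDiff_ambient.mdifferentiableAt (by simp)
  have hc : MDifferentiableAt (𝓡 1) 𝓘(ℝ, ℂ) (fun z : Circle => (z : ℂ)) p.1 :=
    contMDiff_circle_coe.mdifferentiableAt (by simp)
  have hs : MDifferentiableAt (𝓡 2) 𝓘(ℝ, EuclideanSpace ℝ (Fin 3))
      (fun x : S2 => (x : EuclideanSpace ℝ (Fin 3))) p.2 :=
    (contMDiff_coe_sphere (m := ∞)).mdifferentiableAt (by simp)
  have hic : Function.Injective (mfderiv (𝓡 1) 𝓘(ℝ, ℂ) (fun z : Circle => (z : ℂ)) p.1) :=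
    injective_mvfderiv_subtypeVal_sphere (E := ℂ) p.1
  have his : Function.Injective (mfderiv (𝓡 2) 𝓘(ℝ, EuclideanSpace ℝ (Fin 3))
      (fun x : S2 => (x : EuclideanSpace ℝ (Fin 3))) p.2) :=
    injective_mvfderiv_subtypeVal_sphere p.2
  have h1 := (hasMFDerivAt_iff_hasFDerivAt.2
    (hasFDerivAt_fst (𝕜 := ℝ) (p := ambient p))).comp p hA.hasMFDerivAt
  have h1' := hasMFDerivAt_unique h1
    (hc.hasMFDerivAt.comp p (hasMFDerivAt_fst (I := 𝓡 1) (I' := 𝓡 2) p))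
  have h2 := (hasMFDerivAt_iff_hasFDerivAt.2
    (hasFDerivAt_snd (𝕜 := ℝ) (p := ambient p))).comp p hA.hasMFDerivAt
  have h2' := hasMFDerivAt_unique h2
    (hs.hasMFDerivAt.comp p (hasMFDerivAt_snd (I := 𝓡 1) (I' := 𝓡 2) p))
  intro v w hvw
  refine Prod.ext (hic ?_) (his ?_)
  · have hv := DFunLike.congr_fun h1' v
    have hw := DFunLike.congr_fun h1' w
    exact hv.symm.trans ((congrArg Prod.fst hvw).trans hw)
  · have hv := DFunLike.congr_fun h2' v
    have hw := DFunLike.congr_fun h2' w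
    exact hv.symm.trans ((congrArg Prod.snd hvw).trans hw)

/-- The restriction of a diffeomorphism `f` of `S¹ × S²` to a neighbourhood of the north pole in
the sphere over `z`, as a map from `ℝ²` to `ℂ × ℝ³`. -/
def polarRestriction (f : Diff ((𝓡 1).prod (𝓡 2)) (Circle × S2)) (z : Circle) (y : ℝ × ℝ) :
    ℂ × EuclideanSpace ℝ (Fin 3) := ambient (f (z, poleParam y))

theorem contMDiff_slice (z : Circle) : ContMDiff 𝓘(ℝ, ℝ × ℝ) ((𝓡 1).prod (𝓡 2)) ∞
    (fun y : ℝ × ℝ => (z, poleParam y)) :=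
  contMDiff_const.prodMk contMDiff_poleParam

theorem differentiableAt_polarRestriction (f : Diff ((𝓡 1).prod (𝓡 2)) (Circle × S2))
    (z : Circle) : DifferentiableAt ℝ (polarRestriction f z) 0 :=
  (((contMDiff_ambient.comp (f.contMDiff.comp (contMDiff_slice z))).mdifferentiableAt
    (x := (0 : ℝ × ℝ)) (by simp))).differentiableAt

/-- Following the slice under `f` by the sphere component of `f.symm` gives back `poleVec`, whose
derivative is injective; `ambient` is an immersion. -/
theorem fderiv_polarRestriction_injective (f : Diff ((𝓡 1).prod (𝓡 2)) (Circle × S2))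
    (z : Circle) : Function.Injective (fderiv ℝ (polarRestriction f z) 0) := by
  have : Fact (Module.finrank ℝ (EuclideanSpace ℝ (Fin 3)) = 2 + 1) :=
    ⟨finrank_euclideanSpace_fin⟩
  let F : ℝ × ℝ → Circle × S2 := fun y => f (z, poleParam y)
  let G : Circle × S2 → EuclideanSpace ℝ (Fin 3) := fun p => (f.symm p).2
  have hF : MDifferentiableAt 𝓘(ℝ, ℝ × ℝ) ((𝓡 1).prod (𝓡 2)) F 0 :=
    (f.contMDiff.comp (contMDiff_slice z)).mdifferentiableAt (by simp)
  have hG : MDifferentiableAt ((𝓡 1).prod (𝓡 2)) 𝓘(ℝ, EuclideanSpace ℝ (Fin 3)) G (F 0) :=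
    ((contMDiff_coe_sphere (m := ∞)).comp
      (contMDiff_snd.comp f.symm.contMDiff)).mdifferentiableAt (by simp)
  have hA : MDifferentiableAt ((𝓡 1).prod (𝓡 2)) 𝓘(ℝ, ℂ × EuclideanSpace ℝ (Fin 3))
      ambient (F 0) := contMDiff_ambient.mdifferentiableAt (by simp)
  have hGF : G ∘ F = poleVec := by
    funext y
    simp [F, G, poleParam]
  have h1 := hG.hasMFDerivAt.comp 0 hF.hasMFDerivAt
  rw [hGF] at h1
  have h1' := hasMFDerivAt_unique h1 (hasMFDerivAt_iff_hasFDerivAt.2 hasFDerivAt_poleVec)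
  have h2 := hasMFDerivAt_unique (hA.hasMFDerivAt.comp 0 hF.hasMFDerivAt)
    (hasMFDerivAt_iff_hasFDerivAt.2 (differentiableAt_polarRestriction f z).hasFDerivAt)
  have hpole : Function.Injective poleDeriv := by
    intro v w h
    have e0 := congrArg (fun x : EuclideanSpace ℝ (Fin 3) => x 0) h
    have e1 := congrArg (fun x : EuclideanSpace ℝ (Fin 3) => x 1) h
    simp [poleDeriv_apply] at e0 e1
    exact Prod.ext e0 e1
  intro v w h
  have hv := DFunLike.congr_fun h2 v
  have hw := DFunLike.congr_fun h2 w
  have hFvw : mfderiv 𝓘(ℝ, ℝ × ℝ) ((𝓡 1).prod (𝓡 2)) F 0 v =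
      mfderiv 𝓘(ℝ, ℝ × ℝ) ((𝓡 1).prod (𝓡 2)) F 0 w :=
    mfderiv_ambient_injective (F 0) (hv.trans (h.trans hw.symm))
  have hv1 := DFunLike.congr_fun h1' v
  have hw1 := DFunLike.congr_fun h1' w
  exact hpole (hv1.symm.trans ((congrArg (mfderiv ((𝓡 1).prod (𝓡 2))
    𝓘(ℝ, EuclideanSpace ℝ (Fin 3)) G (F 0)) hFvw).trans hw1))

/-- The isomorphism `(w, u) ↦ ⟨i z, w⟩ x + u` from the tangent space of `S¹ × S²` at `(z, x)` to
`ℝ³`, as a function on `ℂ × ℝ³`. -/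
def tangentToVec (p w : ℂ × EuclideanSpace ℝ (Fin 3)) : EuclideanSpace ℝ (Fin 3) :=
  (p.1.re * w.1.im - p.1.im * w.1.re) • p.2 + w.2

theorem tangentToVec_add_smul (p w w' : ℂ × EuclideanSpace ℝ (Fin 3)) (α β : ℝ) :
    tangentToVec p (α • w + β • w') = α • tangentToVec p w + β • tangentToVec p w' := by
  simp only [tangentToVec, Prod.fst_add, Prod.snd_add, Prod.smul_fst, Prod.smul_snd,
    Complex.add_im, Complex.add_re, Complex.smul_re, Complex.smul_im, smul_eq_mul]
  module

theorem eq_zero_of_tangentToVec_eq_zero {p w : ℂ × EuclideanSpace ℝ (Fin 3)}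
    (hp1 : ‖p.1‖ = 1) (hp2 : ‖p.2‖ = 1) (h1 : inner ℝ p.1 w.1 = 0) (h2 : inner ℝ p.2 w.2 = 0)
    (h : tangentToVec p w = 0) : w = 0 := by
  -- Pairing with `p.2` removes `w.2`, leaving the component of `w.1` along `i * p.1`, the only
  -- direction tangent to the circle.
  have hc : p.1.re * w.1.im - p.1.im * w.1.re = 0 := by
    have := congrArg (inner ℝ p.2) h
    simpa [tangentToVec, inner_add_right, inner_smul_right, real_inner_self_eq_norm_sq, hp2, h2]
      using this
  have hw2 : w.2 = 0 := by simpa [tangentToVec, hc] using h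
  have hn : p.1.re * p.1.re + p.1.im * p.1.im = 1 := by
    rw [← Complex.normSq_apply, Complex.normSq_eq_norm_sq, hp1, one_pow]
  have hi : p.1.re * w.1.re + p.1.im * w.1.im = 0 := by
    rw [Complex.inner] at h1
    simpa [mul_comm] using h1
  refine Prod.ext (Complex.ext ?_ ?_) hw2
  · simp only [Prod.fst_zero, Complex.zero_re]
    linear_combination p.1.re * hi - p.1.im * hc - w.1.re * hn
  · simp only [Prod.fst_zero, Complex.zero_im]
    linear_combination p.1.im * hi + p.1.re * hc - w.1.im * hn

/-- The derivative of `f` at the north pole over `z` in the direction `v`, read in the standard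
trivialization of the tangent bundle of `S¹ × S²`. -/
def polarDerivative (f : Diff ((𝓡 1).prod (𝓡 2)) (Circle × S2)) (z : Circle) (v : ℝ × ℝ) :
    EuclideanSpace ℝ (Fin 3) :=
  tangentToVec (polarRestriction f z 0) (fderiv ℝ (polarRestriction f z) 0 v)

theorem polarDerivative_linearIndependent (f : Diff ((𝓡 1).prod (𝓡 2)) (Circle × S2))
    (z : Circle) {α β : ℝ} {v w : ℝ × ℝ}
    (h : α • polarDerivative f z v + β • polarDerivative f z w = 0) : α • v + β • w = 0 := by
  apply fderiv_polarRestriction_injective f z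
  rw [map_zero]
  rw [polarDerivative, polarDerivative, ← tangentToVec_add_smul, ← map_smul, ← map_smul,
    ← map_add] at h
  have hd := (differentiableAt_polarRestriction f z).hasFDerivAt
  have hn1 : ∀ y, ‖(polarRestriction f z y).1‖ = 1 := fun y => Circle.norm_coe _
  have hn2 : ∀ y, ‖(polarRestriction f z y).2‖ = 1 := fun y => norm_eq_of_mem_sphere _
  exact eq_zero_of_tangentToVec_eq_zero (hn1 0) (hn2 0)
    (inner_hasFDerivAt_eq_zero hd.fst hn1 _) (inner_hasFDerivAt_eq_zero hd.snd hn2 _) h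

theorem continuous_polarDerivative {φ : Set.Icc (0 : ℝ) 1 → Diff ((𝓡 1).prod (𝓡 2)) (Circle × S2)}
    (hφ : ContMDiff ((𝓡∂ 1).prod ((𝓡 1).prod (𝓡 2))) ((𝓡 1).prod (𝓡 2)) ∞
      (fun p : Set.Icc (0 : ℝ) 1 × (Circle × S2) => φ p.1 p.2)) (v : ℝ × ℝ) :
    Continuous fun p : Set.Icc (0 : ℝ) 1 × Circle => polarDerivative (φ p.1) p.2 v := by
  let f : Set.Icc (0 : ℝ) 1 × Circle → ℝ × ℝ → ℂ × EuclideanSpace ℝ (Fin 3) :=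
    fun p => polarRestriction (φ p.1) p.2
  have hf : ContMDiff (((𝓡∂ 1).prod (𝓡 1)).prod 𝓘(ℝ, ℝ × ℝ))
      𝓘(ℝ, ℂ × EuclideanSpace ℝ (Fin 3)) ∞ (Function.uncurry f) :=
    contMDiff_ambient.comp (hφ.comp ((contMDiff_fst.comp contMDiff_fst).prodMk
      ((contMDiff_snd.comp contMDiff_fst).prodMk (contMDiff_poleParam.comp contMDiff_snd))))
  have hD : Continuous fun p => fderiv ℝ (f p) 0 := by
    rw [continuous_iff_continuousAt]
    intro p
    -- Joint smoothness makes the partial derivative continuous in the parameter (`m := 0`); between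
    -- vector spaces the tangent coordinates are trivial.
    have h := ContMDiffAt.mfderiv (x₀ := p) (m := 0) f (fun _ => (0 : ℝ × ℝ))
      (hf (p, 0)) contMDiffAt_const (by simp)
    have e := inTangentCoordinates_model_space (I := 𝓘(ℝ, ℝ × ℝ))
      (I' := 𝓘(ℝ, ℂ × EuclideanSpace ℝ (Fin 3))) (fun _ => 0) (fun x => f x 0)
      (fun x => fderiv ℝ (f x) 0) p
    simp only [mfderiv_eq_fderiv] at h
    exact (congrArg (ContinuousAt · p) e).mp h.continuousAt
  have h0 : Continuous fun p => f p 0 := hf.continuous.comp (continuous_id.prodMk continuous_const)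
  have hDv : Continuous fun p => fderiv ℝ (f p) 0 v := hD.clm_apply continuous_const
  change Continuous fun p => ((f p 0).1.re * (fderiv ℝ (f p) 0 v).1.im
    - (f p 0).1.im * (fderiv ℝ (f p) 0 v).1.re) • (f p 0).2 + (fderiv ℝ (f p) 0 v).2
  fun_prop

/-- The circle component is constant on the slice and the rotation is linear. Keeping `w` separate
from `z` covers both ends of the isotopy: `w = 1` and `w = z`. -/
theorem polarDerivative_of_rotation {f : Diff ((𝓡 1).prod (𝓡 2)) (Circle × S2)} {z w : Circle}
    (hf : ∀ x, f (z, x) = (z, rotS2 w x)) (v : ℝ × ℝ) :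
    polarDerivative f z v = rotVec w (poleDeriv v) := by
  let R : EuclideanSpace ℝ (Fin 3) →L[ℝ] EuclideanSpace ℝ (Fin 3) :=
    LinearMap.toContinuousLinearMap
      { toFun := rotVec w
        map_add' := fun x y => by ext i; fin_cases i <;> simp [rotVec] <;> ring
        map_smul' := fun c y => by ext i; fin_cases i <;> simp [rotVec] <;> ring }
  have h1 : polarRestriction f z = fun y => ((z : ℂ), R (poleVec y)) := by
    funext y
    simp only [polarRestriction, hf]
    rfl
  have h2 : HasFDerivAt (polarRestriction f z)
      ((0 : ℝ × ℝ →L[ℝ] ℂ).prod (R.comp poleDeriv)) 0 := by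
    rw [h1]
    exact (hasFDerivAt_const _ _).prodMk (R.hasFDerivAt.comp 0 hasFDerivAt_poleVec)
  rw [polarDerivative, h2.fderiv]
  simp [tangentToVec, R]

theorem twistDiffeo_not_mem_Diff₀ :
    twistDiffeo ∉ Diff₀ ((𝓡 1).prod (𝓡 2)) (Circle × S2) := by
  rintro ⟨φ, hφ, -, h0, h1⟩
  -- The `1 / 2` offsets the factor `2` in `poleDeriv`.
  have e1 : poleDeriv (1 / 2, 0) = !₂[1, 0, 0] := by simp [poleDeriv_apply]
  have e2 : poleDeriv (0, 1 / 2) = !₂[0, 1, 0] := by simp [poleDeriv_apply]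
  have hstart : ∀ z v, polarDerivative (φ 0) z v = poleDeriv v := by
    intro z v
    rw [h0, polarDerivative_of_rotation (w := 1), rotVec_one]
    intro x
    exact congrArg (Prod.mk z) (Subtype.ext (rotVec_one x).symm)
  have hend : ∀ z v, polarDerivative (φ 1) z v = rotVec z (poleDeriv v) := by
    intro z v
    rw [h1]
    exact polarDerivative_of_rotation (fun x => rfl) v
  refine rotation_frame_not_nullhomotopic (fun p => polarDerivative (φ p.1) p.2 (1 / 2, 0))
    (fun p => polarDerivative (φ p.1) p.2 (0, 1 / 2)) (continuous_polarDerivative hφ _)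
    (continuous_polarDerivative hφ _) ?_ (fun z => ?_) (fun z => ?_) (fun z => ?_) (fun z => ?_)
  · intro p α β h
    simpa using polarDerivative_linearIndependent _ _ h
  · exact (hstart z _).trans e1
  · exact (hstart z _).trans e2
  · exact (hend z _).trans (by rw [e1])
  · exact (hend z _).trans (by rw [e2])

end

theorem mainTheorem4 :
    orderOf (QuotientGroup.mk twistDiffeo :
      DiffeotopyGroup ((𝓡 1).prod (𝓡 2)) (Circle × S2)) = 2 := by
  exact orderOf_eq_prime mk_twistDiffeo_sq fun h =>
    twistDiffeo_not_mem_Diff₀ ((QuotientGroup.eq_one_iff _).1 h)
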